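/- Let $n\ge 1$ and $m\ge 0$ be integers, let $C,A_1,\dots,A_m\in\mathbb{R}^{n\times n}$ be symmetric matrices, let $\mathbf b\in\mathbb{R}^m$ and $\beta\in(0,\infty)$, and write $\boldsymbol\lambda\cdot\mathbf A=\sum_{i=1}^m\lambda_iA_i$ for $\boldsymbol\lambda\in\mathbb{R}^m$. Let $\mathcal P_1=\{X\in\mathbb{R}^{n\times n}: X\succeq 0,\ \operatorname{Tr}X=1\}$, let $S(X)=\operatorname{Tr}[X\log X]$ (with $0\log 0=0$), and let $$g_\beta(\boldsymbol\lambda)=\min_{X\in\mathcal P_1}\Big\{\operatorname{Tr}[CX]+\beta^{-1}S(X)-\sum_{i=1}^m\lambda_i\big(\operatorname{Tr}[A_iX]-b_i\big)\Big\},\qquad \boldsymbol\lambda\in\mathbb{R}^m .$$ Let $\|\cdot\|$ be a norm on $\mathbb{R}^m$ such that $\|\boldsymbol\lambda\cdot\mathbf A\|_2\le\|\boldsymbol\lambda\|$ for all $\boldsymbol\lambda\in\mathbb{R}^m$, where $\|\cdot\|_2$ is the spectral norm of a matrix, and let $\|z\|_*=\sup\{z\cdot x:\|x\|\le 1\}$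 be its dual norm. Then the minimum defining $g_\beta$ is attained for every $\boldsymbol\lambda$, $$g_\beta(\boldsymbol\lambda)=\mathbf b\cdot\boldsymbol\lambda-\beta^{-1}\log\operatorname{Tr}\big[e^{-\beta(C-\boldsymbol\lambda\cdot\mathbf A)}\big]\qquad\text{for all }\boldsymbol\lambda\in\mathbb{R}^m,$$ and $g_\beta$ is $\beta$-smooth with respect to $\|\cdot\|$: it is differentiable on $\mathbb{R}^m$ and $$\|\nabla g_\beta(\boldsymbol\lambda)-\nabla g_\beta(\boldsymbol\mu)\|_*\le\beta\,\|\boldsymbol\lambda-\boldsymbol\mu\|\qquad\text{for all }\boldsymbol\lambda,\boldsymbol\mu\in\mathbb{R}^m .$$ -/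

import Mathlib

noncomputable section

namespace EntropicSDP

/-- The Euclidean operator (spectral) norm `‖M‖₂` of a real square matrix. -/
def matrixNorm2 {n : ℕ} (M : Matrix (Fin n) (Fin n) ℝ) : ℝ :=
  ‖Matrix.toEuclideanCLM (𝕜 := ℝ) M‖

/-- The set `𝒫₁` of density matrices: positive semidefinite with unit trace.
(`Matrix.PosSemidef` includes symmetry.) -/
def densityMatrices (n : ℕ) : Set (Matrix (Fin n) (Fin n) ℝ) :=
  {X | X.PosSemidef ∧ X.trace = 1}

/-- The von Neumann entropy `S(X) = Tr[X log X]` of a positive semidefinite matrix, where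
`X log X` is the function `x ↦ x log x` (with `0 log 0 = 0`) applied to `X` by the functional
calculus of symmetric matrices. It is only used on `densityMatrices n`. -/
def vonNeumannEntropy {n : ℕ} (X : Matrix (Fin n) (Fin n) ℝ) : ℝ :=
  (cfc (fun x : ℝ => x * Real.log x) X).trace

/-- `λ · A = ∑ᵢ λᵢ Aᵢ`. -/
def dotMatrix {n m : ℕ} (A : Fin m → Matrix (Fin n) (Fin n) ℝ)
    (lam : EuclideanSpace ℝ (Fin m)) : Matrix (Fin n) (Fin n) ℝ :=
  ∑ i, lam i • A i

/-- The Lagrangian `Tr[C X] + β⁻¹ S(X) - λ · (Tr[A X] - b)`. -/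
def lagrangian {n m : ℕ} (C : Matrix (Fin n) (Fin n) ℝ)
    (A : Fin m → Matrix (Fin n) (Fin n) ℝ) (b : EuclideanSpace ℝ (Fin m)) (β : ℝ)
    (X : Matrix (Fin n) (Fin n) ℝ) (lam : EuclideanSpace ℝ (Fin m)) : ℝ :=
  (C * X).trace + β⁻¹ * vonNeumannEntropy X - ∑ i, lam i * ((A i * X).trace - b i)

/-- The dual objective: the minimum of the Lagrangian over the density matrices. -/
def dualObjective {n m : ℕ} (C : Matrix (Fin n) (Fin n) ℝ)
    (A : Fin m → Matrix (Fin n) (Fin n) ℝ) (b : EuclideanSpace ℝ (Fin m)) (β : ℝ)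
    (lam : EuclideanSpace ℝ (Fin m)) : ℝ :=
  sInf ((fun X => lagrangian C A b β X lam) '' densityMatrices n)

/-- The dual norm `‖z‖_* = sup {⟨z, x⟩ : ‖x‖ ≤ 1}` of a norm `N` on `ℝᵐ`. -/
def dualNorm {m : ℕ} (N : Seminorm ℝ (EuclideanSpace ℝ (Fin m)))
    (z : EuclideanSpace ℝ (Fin m)) : ℝ :=
  sSup ((fun x => inner ℝ z x) '' {x | N x ≤ 1})

/-- `f : ℝᵐ → ℝ` is `L`-smooth with respect to the norm `N`: it is everywhere differentiable
and `‖∇f(x) - ∇f(y)‖_* ≤ L ‖x - y‖`. -/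
def IsSmoothWrt {m : ℕ} (L : ℝ) (N : Seminorm ℝ (EuclideanSpace ℝ (Fin m)))
    (f : EuclideanSpace ℝ (Fin m) → ℝ) : Prop :=
  Differentiable ℝ f ∧
    ∀ x y, dualNorm N (gradient f x - gradient f y) ≤ L * N (x - y)

end EntropicSDP

end

/-! Traces `Tr[f(X) g(Y)]` of symmetric matrices are nonnegative combinations of the `f(xᵢ) g(yⱼ)`,
so scalar inequalities in two variables lift to trace inequalities (`exists_trace_cfc_mul_cfc`).
Lifting `e^t ≥ 1 + t` gives Klein's inequality, hence the Gibbs variational principle: `Tr[XY] -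
S(X)` is at most `log Tr e^Y`, with equality at the Gibbs state. With `Y = -β(C - λ·A)` this yields
attainment and the closed form; it also makes Gibbs states subgradients of the log-partition
function, and their continuity gives differentiability. Smoothness rests on `Tr[(ρ_X - ρ_Y)(X - Y)]
≤ ‖X - Y‖₂²` (`trace_gibbs_sub_le`), obtained by lifting a trapezoid bound for `exp`, with no second
derivative of the matrix exponential. For a convex function, such a bound tested only along `x - y`
upgrades to a Lipschitz bound in the dual norm (`dualNorm_sub_le`). -/

noncomputable section

namespace EntropicSDP

/-! ### Trace inequalities lifted from scalar ones. -/

section MatrixAnalysis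

open scoped Matrix.Norms.L2Operator
open Matrix

variable {n : ℕ} {X Y : Matrix (Fin n) (Fin n) ℝ}

/-- The trace of a product of two functions of symmetric matrices is a nonnegative combination
of the products of the values of the functions at the eigenvalues. -/
theorem exists_trace_cfc_mul_cfc (hX : X.IsHermitian) (hY : Y.IsHermitian) :
    ∃ p : Fin n → Fin n → ℝ, (∀ i j, 0 ≤ p i j) ∧ ∀ f g : ℝ → ℝ,
      (cfc f X * cfc g Y).trace =
        ∑ i, ∑ j, p i j * (f (hX.eigenvalues i) * g (hY.eigenvalues j)) := by
  set U : Matrix (Fin n) (Fin n) ℝ := hX.eigenvectorUnitary.1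
  set V : Matrix (Fin n) (Fin n) ℝ := hY.eigenvectorUnitary.1
  refine ⟨fun i j => ((star U * V) i j) ^ 2, fun i j => sq_nonneg _, fun f g => ?_⟩
  rw [hX.cfc_eq, hY.cfc_eq, IsHermitian.cfc, IsHermitian.cfc, Unitary.conjStarAlgAut_apply,
    Unitary.conjStarAlgAut_apply]
  change (U * diagonal (f ∘ hX.eigenvalues) * star U *
    (V * diagonal (g ∘ hY.eigenvalues) * star V)).trace = _
  have h : (U * diagonal (f ∘ hX.eigenvalues) * star U *
      (V * diagonal (g ∘ hY.eigenvalues) * star V)).trace =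
      (diagonal (f ∘ hX.eigenvalues) * (star U * V) *
        (diagonal (g ∘ hY.eigenvalues) * star (star U * V))).trace := by
    rw [star_mul, star_star, ← Matrix.mul_assoc, ← Matrix.mul_assoc, ← Matrix.mul_assoc,
      ← Matrix.mul_assoc, ← Matrix.mul_assoc, Matrix.trace_mul_comm _ U]
    simp only [Matrix.mul_assoc]
  rw [h, Matrix.trace]
  refine Finset.sum_congr rfl fun i _ => ?_
  rw [Matrix.diag_apply, Matrix.mul_apply]
  refine Finset.sum_congr rfl fun j _ => ?_
  have hs : star (star U * V) j i = (star U * V) i j :=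
    (Matrix.star_apply _ _ _).trans (star_trivial _)
  rw [diagonal_mul, diagonal_mul, hs, Function.comp_apply, Function.comp_apply]
  ring

theorem exp_eq_cfc (hX : X.IsHermitian) : NormedSpace.exp X = cfc Real.exp X :=
  (CFC.real_exp_eq_normedSpace_exp hX.isSelfAdjoint).symm

theorem cfc_eq_self (hX : X.IsHermitian) : cfc (fun x : ℝ => x) X = X :=
  cfc_id' ℝ X hX.isSelfAdjoint

theorem cfc_eq_one (hX : X.IsHermitian) : cfc (fun _ : ℝ => (1 : ℝ)) X = 1 :=
  cfc_const_one ℝ X hX.isSelfAdjoint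

theorem cfc_mul_of_isHermitian (hX : X.IsHermitian) (f g : ℝ → ℝ) :
    cfc f X * cfc g X = cfc (fun x => f x * g x) X := by
  rw [hX.cfc_eq, hX.cfc_eq, hX.cfc_eq, IsHermitian.cfc, IsHermitian.cfc, IsHermitian.cfc,
    ← map_mul, diagonal_mul_diagonal]
  rfl

theorem posSemidef_exp (hX : X.IsHermitian) : (NormedSpace.exp X).PosSemidef := by
  have h : X = (2⁻¹ : ℝ) • X + (2⁻¹ : ℝ) • X := by rw [← add_smul]; norm_num
  have hh : ((2⁻¹ : ℝ) • X).IsHermitian := by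
    rw [IsHermitian, conjTranspose_smul, hX.eq]; simp
  rw [h, Matrix.exp_add_of_commute _ _ (Commute.refl _)]
  conv => arg 1; arg 1; rw [← hh.exp.eq]
  exact posSemidef_conjTranspose_mul_self _

theorem trace_exp_pos (hn : 1 ≤ n) (hX : X.IsHermitian) : 0 < (NormedSpace.exp X).trace := by
  have : Nonempty (Fin n) := ⟨⟨0, hn⟩⟩
  have hp := posSemidef_exp hX
  refine lt_of_le_of_ne hp.trace_nonneg fun h => ?_
  have h0 := (hp.trace_eq_zero_iff).1 h.symm
  have := Matrix.isUnit_exp X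
  rw [h0] at this
  exact not_isUnit_zero this

/-- For `x > 0` this is `e^t ≥ 1 + t` at `t = y - log x`, multiplied by `x`. -/
theorem klein_scalar {x : ℝ} (hx : 0 ≤ x) (y : ℝ) :
    0 ≤ x * Real.log x - x * y - x + Real.exp y := by
  rcases hx.eq_or_lt with rfl | hx
  · simp [Real.exp_nonneg]
  · have h := Real.add_one_le_exp (y - Real.log x)
    rw [Real.exp_sub, Real.exp_log hx, le_div_iff₀ hx] at h
    nlinarith

/-- **Klein's inequality** for the entropy. -/
theorem klein_inequality (hX : X.PosSemidef) (hY : Y.IsHermitian) :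
    0 ≤ vonNeumannEntropy X - (X * Y).trace - X.trace + (NormedSpace.exp Y).trace := by
  obtain ⟨p, hp, h⟩ := exists_trace_cfc_mul_cfc hX.isHermitian hY
  have h1 := h (fun x => x * Real.log x) (fun _ => 1)
  have h2 := h (fun x => x) (fun x => x)
  have h3 := h (fun x => x) (fun _ => 1)
  have h4 := h (fun _ => 1) Real.exp
  rw [cfc_eq_one hY, Matrix.mul_one] at h1 h3
  rw [cfc_eq_self hX.isHermitian] at h2 h3
  rw [cfc_eq_self hY] at h2
  rw [cfc_eq_one hX.isHermitian, Matrix.one_mul, ← exp_eq_cfc hY] at h4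
  rw [vonNeumannEntropy, h1, h2, h3, h4]
  simp only [← Finset.sum_sub_distrib, ← Finset.sum_add_distrib]
  refine Finset.sum_nonneg fun i _ => Finset.sum_nonneg fun j _ => ?_
  have := mul_nonneg (hp i j)
    (klein_scalar (hX.eigenvalues_nonneg i) (hY.eigenvalues j))
  linarith

/-- The trapezoid rule overestimates the integral of the convex function `exp` over `[0, d]`. -/
theorem exp_sub_one_le {d : ℝ} (hd : 0 ≤ d) : Real.exp d - 1 ≤ d * (Real.exp d + 1) / 2 := by
  let h : ℝ → ℝ := fun d => d * (Real.exp d + 1) / 2 - (Real.exp d - 1)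
  have hder : ∀ t, HasDerivAt h
      ((1 * (Real.exp t + 1) + t * Real.exp t) / 2 - Real.exp t) t := fun t =>
    (((hasDerivAt_id t).mul ((Real.hasDerivAt_exp t).add_const 1)).div_const 2).sub
      ((Real.hasDerivAt_exp t).sub_const 1)
  have hmono : Monotone h := by
    refine monotone_of_deriv_nonneg (fun t => (hder t).differentiableAt) fun t => ?_
    rw [(hder t).deriv]
    -- The derivative is `(1 + t e^t - e^t) / 2`, nonnegative because `e^{-t} ≥ 1 - t`.
    have h1 := Real.add_one_le_exp (-t)
    rw [Real.exp_neg, ← one_div, le_div_iff₀ (Real.exp_pos t)] at h1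
    linarith
  have := hmono hd
  simp only [h] at this
  norm_num at this
  linarith

theorem sub_mul_exp_sub_exp_le (x y : ℝ) :
    (x - y) * (Real.exp x - Real.exp y) ≤ (x - y) ^ 2 * (Real.exp x + Real.exp y) / 2 := by
  wlog hxy : y ≤ x generalizing x y
  · have := this y x (le_of_not_ge hxy)
    nlinarith
  have h := exp_sub_one_le (sub_nonneg.2 hxy)
  rw [Real.exp_sub] at h
  have h2 : Real.exp x - Real.exp y ≤ (x - y) * (Real.exp x + Real.exp y) / 2 := by
    have hy := Real.exp_pos y
    have := mul_le_mul_of_nonneg_right h hy.le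
    field_simp at this
    linarith
  nlinarith [mul_le_mul_of_nonneg_left h2 (sub_nonneg.2 hxy)]

/-- Since `X` commutes with `e^X` and `Y` with `e^Y`, cyclicity of the trace turns every term of the
expansion into the form `Tr[f(X) g(Y)]`; the scalar inequality then applies at each pair of
eigenvalues. -/
theorem trace_sub_mul_exp_sub_exp_le (hX : X.IsHermitian) (hY : Y.IsHermitian) :
    ((X - Y) * (NormedSpace.exp X - NormedSpace.exp Y)).trace ≤
      ((X - Y) * (X - Y) * (NormedSpace.exp X + NormedSpace.exp Y)).trace / 2 := by
  obtain ⟨p, hp, h⟩ := exists_trace_cfc_mul_cfc hX hY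
  have hmul : ∀ {Z : Matrix (Fin n) (Fin n) ℝ}, Z.IsHermitian →
      cfc (fun x => x * Real.exp x) Z = Z * NormedSpace.exp Z ∧
      cfc (fun x => x * (x * Real.exp x)) Z = Z * (Z * NormedSpace.exp Z) ∧
      cfc (fun x : ℝ => x * x) Z = Z * Z ∧ NormedSpace.exp Z * Z = Z * NormedSpace.exp Z := by
    intro Z hZ
    have e := exp_eq_cfc hZ
    have i := cfc_eq_self hZ
    have h1 : cfc (fun x => x * Real.exp x) Z = Z * NormedSpace.exp Z := by
      rw [← cfc_mul_of_isHermitian hZ (fun x => x), i, e]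
    refine ⟨h1, ?_, ?_, ?_⟩
    · rw [← cfc_mul_of_isHermitian hZ (fun x => x), i, h1]
    · rw [← cfc_mul_of_isHermitian hZ (fun x => x), i]
    · rw [← h1, e]
      conv_lhs => arg 2; rw [← i]
      rw [cfc_mul_of_isHermitian hZ]
      simp only [mul_comm]
  obtain ⟨hX1, hX2, hX3, hX4⟩ := hmul hX
  obtain ⟨hY1, hY2, hY3, hY4⟩ := hmul hY
  have eX := exp_eq_cfc hX
  have eY := exp_eq_cfc hY
  have a1 := h (fun x => x * Real.exp x) (fun _ => 1)
  have a2 := h (fun x => x) Real.exp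
  have a3 := h Real.exp (fun x => x)
  have a4 := h (fun _ => 1) (fun x => x * Real.exp x)
  have b1 := h (fun x => x * (x * Real.exp x)) (fun _ => 1)
  have b2 := h (fun x => x * Real.exp x) (fun x => x)
  have b3 := h Real.exp (fun x => x * x)
  have b4 := h (fun x => x * x) Real.exp
  have b5 := h (fun x => x) (fun x => x * Real.exp x)
  have b6 := h (fun _ => 1) (fun x => x * (x * Real.exp x))
  simp only [hX1, hX2, hX3, hY1, hY2, hY3, cfc_eq_one hX, cfc_eq_one hY, cfc_eq_self hX,
    cfc_eq_self hY, ← eX, ← eY, Matrix.mul_one, Matrix.one_mul] at a1 a2 a3 a4 b1 b2 b3 b4 b5 b6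
  set P := NormedSpace.exp X
  set Q := NormedSpace.exp Y
  have l : ((X - Y) * (P - Q)).trace =
      (X * P).trace - (X * Q).trace - (P * Y).trace + (Y * Q).trace := by
    simp only [Matrix.sub_mul, Matrix.mul_sub, trace_sub]
    rw [Matrix.trace_mul_comm Y P]
    ring
  have r : ((X - Y) * (X - Y) * (P + Q)).trace =
      (X * (X * P)).trace - 2 * (X * P * Y).trace + (P * (Y * Y)).trace
      + (X * X * Q).trace - 2 * (X * (Y * Q)).trace + (Y * (Y * Q)).trace := by
    simp only [Matrix.sub_mul, Matrix.mul_sub, Matrix.mul_add, trace_sub, trace_add]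
    have t1 : (Y * X * P).trace = (X * P * Y).trace := by
      rw [Matrix.mul_assoc, Matrix.trace_mul_comm]
    have t2 : (X * Y * P).trace = (X * P * Y).trace := by
      rw [← hX4, Matrix.trace_mul_comm, Matrix.mul_assoc]
    have t3 : (Y * Y * P).trace = (P * (Y * Y)).trace := Matrix.trace_mul_comm _ _
    have t4 : (Y * X * Q).trace = (X * (Y * Q)).trace := by
      rw [← hY4, Matrix.mul_assoc, Matrix.trace_mul_comm Y, Matrix.mul_assoc]
    rw [t1, t2, t3, t4]
    simp only [Matrix.mul_assoc]
    ring
  rw [l, r, a1, a2, a3, a4, b1, b2, b3, b4, b5, b6]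
  simp only [Finset.mul_sum, ← Finset.sum_sub_distrib, ← Finset.sum_add_distrib, Finset.sum_div]
  refine Finset.sum_le_sum fun i _ => Finset.sum_le_sum fun j _ => ?_
  have := mul_le_mul_of_nonneg_left
    (sub_mul_exp_sub_exp_le (hX.eigenvalues i) (hY.eigenvalues j)) (hp i j)
  linarith

/-- `Tr[V² X] ≤ ‖V‖² Tr X` for positive semidefinite `X`. -/
theorem trace_mul_self_mul_le {V : Matrix (Fin n) (Fin n) ℝ} (hV : V.IsHermitian)
    (hX : X.PosSemidef) : (V * V * X).trace ≤ matrixNorm2 V ^ 2 * X.trace := by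
  obtain ⟨p, hp, h⟩ := exists_trace_cfc_mul_cfc hV hX.isHermitian
  have h1 := h (fun x => x * x) (fun x => x)
  have h2 := h (fun _ => 1) (fun x => x)
  rw [← cfc_mul_of_isHermitian hV (fun x => x) (fun x => x), cfc_eq_self hV,
    cfc_eq_self hX.isHermitian] at h1
  rw [cfc_eq_one hV, Matrix.one_mul, cfc_eq_self hX.isHermitian] at h2
  rw [h1, h2]
  simp only [Finset.mul_sum]
  refine Finset.sum_le_sum fun i _ => Finset.sum_le_sum fun j _ => ?_
  have hi : |hV.eigenvalues i| ≤ matrixNorm2 V := by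
    have : Nonempty (Fin n) := ⟨i⟩
    exact spectrum.norm_le_norm_of_mem (hV.eigenvalues_mem_spectrum_real i)
  have := mul_le_mul_of_nonneg_left (sq_le_sq.2 (hi.trans (le_abs_self _)))
    (mul_nonneg (hp i j) (hX.eigenvalues_nonneg j))
  linarith

end MatrixAnalysis

/-! ### From a monotonicity bound on subgradients to smoothness in a general norm. -/

section SmoothConvex

open Filter Topology

/-- A function with a continuous field of subgradients is differentiable. -/
theorem hasGradientAt_of_subgradient {E : Type*} [NormedAddCommGroup E] [InnerProductSpace ℝ E]
    [CompleteSpace E] {f : E → ℝ} {g : E → E} (hsub : ∀ x y, f x + inner ℝ (g x) (y - x) ≤ f y)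
    (hg : Continuous g) (x : E) : HasGradientAt f (g x) x := by
  rw [hasGradientAt_iff_isLittleO, Asymptotics.isLittleO_iff]
  intro c hc
  have : ∀ᶠ y in 𝓝 x, ‖g y - g x‖ < c := by
    have := (hg.tendsto x).eventually (Metric.ball_mem_nhds (g x) hc)
    simpa [dist_eq_norm] using this
  filter_upwards [this] with y hy
  have h1 := hsub x y
  have h2 := hsub y x
  have h3 := real_inner_le_norm (g y - g x) (y - x)
  rw [inner_sub_left] at h3
  rw [← neg_sub y x, inner_neg_right] at h2
  rw [Real.norm_eq_abs, abs_of_nonneg (by linarith)]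
  have := mul_le_mul_of_nonneg_right hy.le (norm_nonneg (y - x))
  linarith

/-- A convex function whose gradient satisfies `⟨∇f x - ∇f y, x - y⟩ ≤ L N(x - y)²` lies below
its quadratic expansions. -/
theorem le_quadratic {E : Type*} [NormedAddCommGroup E] [InnerProductSpace ℝ E]
    [CompleteSpace E] {f : E → ℝ} {g : E → E} (N : Seminorm ℝ E) {L : ℝ}
    (hfg : ∀ x, HasGradientAt f (g x) x)
    (hmon : ∀ x y, inner ℝ (g x - g y) (x - y) ≤ L * N (x - y) ^ 2) (x y : E) :
    f y ≤ f x + inner ℝ (g x) (y - x) + L / 2 * N (y - x) ^ 2 := by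
  set v := y - x with hv
  -- Up to the constant `f x`, the gap in the claim along the segment; the claim is `h 0 ≤ h 1`.
  let h : ℝ → ℝ := fun t => t * inner ℝ (g x) v + L / 2 * N v ^ 2 * t ^ 2 - f (x + t • v)
  have hder : ∀ t, HasDerivAt h
      (1 * inner ℝ (g x) v + L / 2 * N v ^ 2 * (2 * t) - inner ℝ (g (x + t • v)) v) t := by
    intro t
    have h1 : HasDerivAt (fun t : ℝ => x + t • v) v t := by
      simpa using ((hasDerivAt_id t).smul_const v).const_add x
    have h2 := ((hfg (x + t • v)).hasFDerivAt).comp_hasDerivAt t h1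
    rw [InnerProductSpace.toDual_apply_apply] at h2
    refine (((hasDerivAt_id t).mul_const _).add (HasDerivAt.const_mul _ ?_)).sub h2
    simpa using hasDerivAt_pow 2 t
  have hmono : MonotoneOn h (Set.Ici 0) := by
    refine monotoneOn_of_deriv_nonneg (convex_Ici 0)
      (fun t _ => (hder t).continuousAt.continuousWithinAt)
      (fun t _ => (hder t).differentiableAt.differentiableWithinAt) fun t ht => ?_
    rw [interior_Ici, Set.mem_Ioi] at ht
    rw [(hder t).deriv]
    have := hmon (x + t • v) x
    rw [add_sub_cancel_left, map_smul_eq_mul, inner_smul_right, inner_sub_left,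
      Real.norm_eq_abs, abs_of_pos ht] at this
    have h3 : inner ℝ (g (x + t • v)) v - inner ℝ (g x) v ≤ L * N v ^ 2 * t := by
      refine le_of_mul_le_mul_left ?_ ht
      linarith
    linarith
  have := hmono (Set.mem_Ici.2 le_rfl) (Set.mem_Ici.2 zero_le_one) zero_le_one
  simp only [h] at this
  simp [hv] at this
  rw [hv]
  linarith

/-- At a displaced point `y + w`, the tangent at `x` lies below `f` and the quadratic expansion at
`y` lies above it. Comparing them tests `g x - g y` in an arbitrary direction `w`. -/
theorem dualNorm_sub_le {m : ℕ} {f : EuclideanSpace ℝ (Fin m) → ℝ}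
    {g : EuclideanSpace ℝ (Fin m) → EuclideanSpace ℝ (Fin m)}
    (N : Seminorm ℝ (EuclideanSpace ℝ (Fin m))) (hN : ∀ x, N x = 0 → x = 0) {L : ℝ}
    (hL : 0 ≤ L) (hsub : ∀ x y, f x + inner ℝ (g x) (y - x) ≤ f y) (hg : Continuous g)
    (hmon : ∀ x y, inner ℝ (g x - g y) (x - y) ≤ L * N (x - y) ^ 2)
    (x y : EuclideanSpace ℝ (Fin m)) : dualNorm N (g x - g y) ≤ L * N (x - y) := by
  have hq := le_quadratic N (hasGradientAt_of_subgradient hsub hg) hmon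
  refine csSup_le ⟨_, 0, by simp, rfl⟩ ?_
  rintro _ ⟨u, hu, rfl⟩
  change N u ≤ 1 at hu
  change inner ℝ (g x - g y) u ≤ _
  rcases (apply_nonneg N (x - y)).eq_or_lt with h0 | hd
  · rw [sub_eq_zero.1 (hN _ h0.symm)]
    simp
  set d := N (x - y) with hd'
  have key : ∀ (x y : EuclideanSpace ℝ (Fin m)) (w : EuclideanSpace ℝ (Fin m)),
      inner ℝ (g x - g y) w ≤ f y - f x - inner ℝ (g x) (y - x) + L / 2 * N w ^ 2 := by
    intro x y w
    have h1 := hsub x (y + w)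
    have h2 := hq y (y + w)
    rw [add_sub_cancel_left] at h2
    have : y + w - x = (y - x) + w := by abel
    rw [this, inner_add_right] at h1
    rw [inner_sub_left]
    linarith
  -- With displacements of size at most `d` and the roles of `x`, `y` swapped, the values of `f`
  -- cancel in the sum: `2d⟪g x - g y, u⟫ ≤ ⟪g x - g y, x - y⟫ + L d² ≤ 2L d²`.
  have h1 := key x y (d • u)
  have h2 := key y x (-(d • u))
  have h3 := hmon x y
  rw [map_neg_eq_map, inner_neg_right] at h2
  rw [inner_sub_left, inner_smul_right, inner_smul_right, map_smul_eq_mul, Real.norm_eq_abs,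
    abs_of_pos hd] at h1 h2
  rw [← neg_sub x y, inner_neg_right] at h1
  rw [inner_sub_left] at h3 ⊢
  have h4 : (d * N u) ^ 2 ≤ d ^ 2 := by
    have := apply_nonneg N u
    refine pow_le_pow_left₀ (by positivity) ?_ 2
    nlinarith
  have h5 := mul_le_mul_of_nonneg_left h4 hL
  refine le_of_mul_le_mul_left ?_ hd
  linarith

end SmoothConvex

/-! ### Gibbs states: variational principle and monotonicity bound. -/

section GibbsState

open scoped Matrix.Norms.L2Operator
open Matrix

variable {n : ℕ}

/-- The log-partition function `log Tr exp Y`. -/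
def logPartition (Y : Matrix (Fin n) (Fin n) ℝ) : ℝ :=
  Real.log (NormedSpace.exp Y).trace

/-- The matrix `Y - (log Tr exp Y) 1`, whose exponential has unit trace. -/
def normalize (Y : Matrix (Fin n) (Fin n) ℝ) : Matrix (Fin n) (Fin n) ℝ :=
  Y - logPartition Y • (1 : Matrix (Fin n) (Fin n) ℝ)

/-- The Gibbs state `exp Y / Tr exp Y`. -/
def gibbs (Y : Matrix (Fin n) (Fin n) ℝ) : Matrix (Fin n) (Fin n) ℝ :=
  NormedSpace.exp (normalize Y)

variable {X Y : Matrix (Fin n) (Fin n) ℝ}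

theorem isHermitian_normalize (hY : Y.IsHermitian) : (normalize Y).IsHermitian := by
  rw [normalize]
  refine hY.sub ?_
  rw [IsHermitian, conjTranspose_smul, conjTranspose_one, star_trivial]

theorem gibbs_eq_smul (hn : 1 ≤ n) (hY : Y.IsHermitian) :
    gibbs Y = (NormedSpace.exp Y).trace⁻¹ • NormedSpace.exp Y := by
  have h1 : NormedSpace.exp (-(logPartition Y • (1 : Matrix (Fin n) (Fin n) ℝ))) =
      (NormedSpace.exp Y).trace⁻¹ • (1 : Matrix (Fin n) (Fin n) ℝ) := by
    rw [← neg_smul, smul_one_eq_diagonal, Matrix.exp_diagonal, smul_one_eq_diagonal]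
    congr 1
    ext i
    rw [Pi.coe_exp, ← Real.exp_eq_exp_ℝ, Real.exp_neg, logPartition,
      Real.exp_log (trace_exp_pos hn hY)]
  rw [gibbs, normalize, sub_eq_add_neg, Matrix.exp_add_of_commute, h1, mul_smul_comm,
    Matrix.mul_one]
  exact ((Commute.one_right Y).smul_right _).neg_right

theorem gibbs_mem_densityMatrices (hn : 1 ≤ n) (hY : Y.IsHermitian) :
    gibbs Y ∈ densityMatrices n := by
  refine ⟨posSemidef_exp (isHermitian_normalize hY), ?_⟩
  rw [gibbs_eq_smul hn hY, trace_smul, smul_eq_mul,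
    inv_mul_cancel₀ (trace_exp_pos hn hY).ne']

theorem trace_mul_normalize {Z : Matrix (Fin n) (Fin n) ℝ} (hZ : Z.trace = 1) :
    (Z * normalize Y).trace = (Z * Y).trace - logPartition Y := by
  rw [normalize, Matrix.mul_sub, trace_sub, mul_smul_comm, Matrix.mul_one, trace_smul, hZ,
    smul_eq_mul, mul_one]

/-- The **Gibbs variational principle**. -/
theorem trace_mul_sub_entropy_le (hn : 1 ≤ n) (hX : X ∈ densityMatrices n)
    (hY : Y.IsHermitian) : (X * Y).trace - vonNeumannEntropy X ≤ logPartition Y := by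
  have h := klein_inequality hX.1 (isHermitian_normalize hY)
  have h2 := (gibbs_mem_densityMatrices hn hY).2
  rw [gibbs] at h2
  rw [trace_mul_normalize hX.2, h2, hX.2] at h
  linarith

theorem trace_gibbs_mul_sub_entropy (hn : 1 ≤ n) (hY : Y.IsHermitian) :
    (gibbs Y * Y).trace - vonNeumannEntropy (gibbs Y) = logPartition Y := by
  have hY' := isHermitian_normalize hY
  -- The spectrum is finite, so the composition rule for the functional calculus needs no genuine
  -- continuity.
  have hc : ∀ f : ℝ → ℝ, ContinuousOn f (Real.exp '' spectrum ℝ (normalize Y)) := fun f =>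
    ((normalize Y).finite_real_spectrum.image _).continuousOn f
  have h : vonNeumannEntropy (gibbs Y) = (gibbs Y * normalize Y).trace := by
    rw [vonNeumannEntropy, gibbs]
    conv_rhs => arg 1; arg 2; rw [← cfc_eq_self hY']
    rw [exp_eq_cfc hY', cfc_mul_of_isHermitian hY',
      ← cfc_comp' (fun x => x * Real.log x) Real.exp (normalize Y) (hc _)
        Real.continuous_exp.continuousOn hY'.isSelfAdjoint]
    simp only [Real.log_exp]
  rw [h, trace_mul_normalize (gibbs_mem_densityMatrices hn hY).2]
  ring

/-- The state `gibbs X` is optimal in the variational principle for `X` and a competitor in that for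
`Y`; its entropy cancels. -/
theorem logPartition_subgradient (hn : 1 ≤ n) (hX : X.IsHermitian) (hY : Y.IsHermitian) :
    logPartition X + (gibbs X * (Y - X)).trace ≤ logPartition Y := by
  have h1 := trace_gibbs_mul_sub_entropy hn hX
  have h2 := trace_mul_sub_entropy_le hn (gibbs_mem_densityMatrices hn hX) hY
  rw [Matrix.mul_sub, trace_sub]
  linarith

theorem trace_gibbs_sub_le_of_nonneg (hn : 1 ≤ n) (hX : X.IsHermitian) (hY : Y.IsHermitian)
    (h : 0 ≤ (gibbs X * (X - Y)).trace * (gibbs Y * (X - Y)).trace) :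
    (gibbs X * (X - Y)).trace - (gibbs Y * (X - Y)).trace ≤ matrixNorm2 (X - Y) ^ 2 := by
  have hgX := gibbs_mem_densityMatrices hn hX
  have hgY := gibbs_mem_densityMatrices hn hY
  have k := trace_sub_mul_exp_sub_exp_le (isHermitian_normalize hX) (isHermitian_normalize hY)
  have s1 := logPartition_subgradient hn hX hY
  have s2 := logPartition_subgradient hn hY hX
  have n1 := trace_mul_self_mul_le (hX.sub hY) hgX.1
  have n2 := trace_mul_self_mul_le (hX.sub hY) hgY.1
  rw [hgX.2, mul_one] at n1
  rw [hgY.2, mul_one] at n2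
  rw [← neg_sub X Y, Matrix.mul_neg, trace_neg] at s1
  change (_ * (gibbs X - gibbs Y)).trace ≤ (_ * (gibbs X + gibbs Y)).trace / 2 at k
  set c := logPartition X - logPartition Y with hc
  set V := X - Y with hV
  have e : normalize X - normalize Y = V - c • (1 : Matrix (Fin n) (Fin n) ℝ) := by
    rw [normalize, normalize, hV, hc, sub_smul]
    abel
  rw [e] at k
  simp only [Matrix.sub_mul, Matrix.mul_sub, Matrix.mul_add, trace_sub, trace_add, smul_mul_assoc,
    mul_smul_comm, Matrix.one_mul, Matrix.mul_one, trace_smul, smul_eq_mul, hgX.2, hgY.2] at k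
  rw [Matrix.trace_mul_comm V (gibbs X), Matrix.trace_mul_comm V (gibbs Y)] at k
  -- Write `a`, `r` for the traces of `V` against `gibbs X`, `gibbs Y`. Here `k` and the norm bounds
  -- give `a - r ≤ ‖V‖² - c(a + r) + c²`, and the subgradient inequalities `r ≤ c ≤ a` give `c² -
  -- c(a + r) ≤ -ar ≤ 0`.
  nlinarith [mul_nonneg (show 0 ≤ c - (gibbs Y * V).trace by linarith)
    (show 0 ≤ (gibbs X * V).trace - c by linarith)]

theorem continuous_gibbs_comp (hn : 1 ≤ n) {T : Type*} [TopologicalSpace T]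
    {M : T → Matrix (Fin n) (Fin n) ℝ} (hM : Continuous M) (hM' : ∀ t, (M t).IsHermitian) :
    Continuous fun t => gibbs (M t) := by
  let _ : NormedAlgebra ℚ (Matrix (Fin n) (Fin n) ℝ) := .restrictScalars ℚ ℝ _
  have he : Continuous fun t => NormedSpace.exp (M t) := NormedSpace.exp_continuous.comp hM
  simp only [fun t => gibbs_eq_smul hn (hM' t)]
  exact (he.matrix_trace.inv₀ fun t => (trace_exp_pos hn (hM' t)).ne').smul he

theorem matrixNorm2_smul (c : ℝ) (M : Matrix (Fin n) (Fin n) ℝ) :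
    matrixNorm2 (c • M) = |c| * matrixNorm2 M :=
  norm_smul c M

/-- The Gibbs state satisfies `Tr[(ρ_X - ρ_Y)(X - Y)] ≤ ‖X - Y‖₂²`. -/
theorem trace_gibbs_sub_le (hn : 1 ≤ n) (hX : X.IsHermitian) (hY : Y.IsHermitian) :
    (gibbs X * (X - Y)).trace - (gibbs Y * (X - Y)).trace ≤ matrixNorm2 (X - Y) ^ 2 := by
  rcases le_or_gt 0 ((gibbs X * (X - Y)).trace * (gibbs Y * (X - Y)).trace) with h | h
  · exact trace_gibbs_sub_le_of_nonneg hn hX hY h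
  have hV := hX.sub hY
  set V := X - Y with hVdef
  rcases le_or_gt ((gibbs X * V).trace) 0 with hs | hs
  · have : 0 ≤ (gibbs Y * V).trace := by
      by_contra hr
      nlinarith
    have := sq_nonneg (matrixNorm2 V)
    linarith
  have hr : (gibbs Y * V).trace < 0 := by
    by_contra hr
    nlinarith
  let M : ℝ → Matrix (Fin n) (Fin n) ℝ := fun t => Y + t • V
  have hM : Continuous M := by fun_prop
  have hM' : ∀ t, (M t).IsHermitian := fun t => hY.add <| by
    rw [IsHermitian, conjTranspose_smul, hV.eq, star_trivial]
  let ψ : ℝ → ℝ := fun t => (gibbs (M t) * V).trace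
  have hψ : Continuous ψ := ((continuous_gibbs_comp hn hM hM').matrix_mul
    continuous_const).matrix_trace
  have M0 : M 0 = Y := by simp [M]
  have M1 : M 1 = X := by simp [M, hVdef]
  -- When the two traces have opposite signs, split the segment where the trace against `V`
  -- vanishes: on each half the sign condition holds with product zero.
  obtain ⟨t, ⟨ht0, ht1⟩, ht⟩ := intermediate_value_Icc zero_le_one hψ.continuousOn
    (show (0 : ℝ) ∈ Set.Icc (ψ 0) (ψ 1) from ⟨by simp only [ψ, M0]; exact hr.le,
      by simp only [ψ, M1]; exact hs.le⟩)
  have ht0' : 0 < t := by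
    refine lt_of_le_of_ne ht0 ?_
    rintro rfl
    simp only [ψ, M0] at ht
    linarith
  have ht1' : t < 1 := by
    refine lt_of_le_of_ne ht1 ?_
    rintro rfl
    simp only [ψ, M1] at ht
    linarith
  simp only [ψ] at ht
  have eX : X - M t = (1 - t) • V := by
    simp only [M, hVdef, sub_smul, one_smul]
    abel
  have eY : M t - Y = t • V := by simp [M]
  have b1 := trace_gibbs_sub_le_of_nonneg hn hX (hM' t) (by simp [eX, ht])
  have b2 := trace_gibbs_sub_le_of_nonneg hn (hM' t) hY (by simp [eY, ht])
  rw [eX, matrixNorm2_smul, mul_smul_comm, mul_smul_comm, trace_smul, trace_smul, ht, smul_zero,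
    sub_zero, smul_eq_mul, abs_of_pos (sub_pos.2 ht1')] at b1
  rw [eY, matrixNorm2_smul, mul_smul_comm, mul_smul_comm, trace_smul, trace_smul, ht, smul_zero,
    zero_sub, smul_eq_mul, abs_of_pos ht0'] at b2
  -- Each half is quadratic in its length; cancelling one factor makes the bounds linear, with
  -- weights `1 - t` and `t` that add up to one.
  have c1 : (gibbs X * V).trace ≤ (1 - t) * matrixNorm2 V ^ 2 :=
    le_of_mul_le_mul_left (by linarith) (sub_pos.2 ht1')
  have c2 : -(gibbs Y * V).trace ≤ t * matrixNorm2 V ^ 2 :=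
    le_of_mul_le_mul_left (by linarith) ht0'
  linarith

end GibbsState

/-! ### The dual objective as a log-partition function. -/

section Dual

variable {n m : ℕ} {C : Matrix (Fin n) (Fin n) ℝ} {A : Fin m → Matrix (Fin n) (Fin n) ℝ}

/-- The matrix `-β (C - λ · A)`. -/
def dualExponent (C : Matrix (Fin n) (Fin n) ℝ) (A : Fin m → Matrix (Fin n) (Fin n) ℝ) (β : ℝ)
    (lam : EuclideanSpace ℝ (Fin m)) : Matrix (Fin n) (Fin n) ℝ :=
  -(β • (C - dotMatrix A lam))

theorem isHermitian_dualExponent (hC : C.IsSymm) (hA : ∀ i, (A i).IsSymm) (β : ℝ)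
    (lam : EuclideanSpace ℝ (Fin m)) : (dualExponent C A β lam).IsHermitian := by
  rw [Matrix.IsHermitian, Matrix.conjTranspose_eq_transpose_of_trivial]
  simp [dualExponent, dotMatrix, Matrix.transpose_sum, hC.eq, fun i => (hA i).eq]

theorem continuous_dualExponent (β : ℝ) : Continuous (dualExponent C A β) := by
  unfold dualExponent dotMatrix
  fun_prop

theorem dualExponent_sub (β : ℝ) (x y : EuclideanSpace ℝ (Fin m)) :
    dualExponent C A β x - dualExponent C A β y = β • dotMatrix A (x - y) := by
  have : dotMatrix A (x - y) = dotMatrix A x - dotMatrix A y := by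
    simp [dotMatrix, sub_smul]
  rw [dualExponent, dualExponent, this, smul_sub, smul_sub, smul_sub]
  abel

theorem trace_mul_dotMatrix (X : Matrix (Fin n) (Fin n) ℝ) (lam : EuclideanSpace ℝ (Fin m)) :
    (X * dotMatrix A lam).trace = ∑ i, lam i * (A i * X).trace := by
  simp [dotMatrix, Matrix.mul_sum, Matrix.trace_sum, Matrix.trace_mul_comm X]

theorem lagrangian_eq (b : EuclideanSpace ℝ (Fin m)) {β : ℝ} (hβ : 0 < β)
    (X : Matrix (Fin n) (Fin n) ℝ) (lam : EuclideanSpace ℝ (Fin m)) :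
    lagrangian C A b β X lam = inner ℝ b lam -
      β⁻¹ * ((X * dualExponent C A β lam).trace - vonNeumannEntropy X) := by
  have h : (X * dualExponent C A β lam).trace =
      -(β * ((C * X).trace - ∑ i, lam i * (A i * X).trace)) := by
    rw [dualExponent, Matrix.mul_neg, Matrix.trace_neg, mul_smul_comm, Matrix.trace_smul,
      Matrix.mul_sub, Matrix.trace_sub, trace_mul_dotMatrix, smul_eq_mul, Matrix.trace_mul_comm X]
  rw [h, lagrangian, PiLp.inner_apply]
  simp only [mul_sub, Finset.sum_sub_distrib, RCLike.inner_apply, conj_trivial]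
  field_simp
  ring

theorem isLeast_lagrangian (hn : 1 ≤ n) (hC : C.IsSymm) (hA : ∀ i, (A i).IsSymm)
    (b : EuclideanSpace ℝ (Fin m)) {β : ℝ} (hβ : 0 < β) (lam : EuclideanSpace ℝ (Fin m)) :
    IsLeast ((fun X => lagrangian C A b β X lam) '' densityMatrices n)
      (inner ℝ b lam - β⁻¹ * logPartition (dualExponent C A β lam)) := by
  have hY := isHermitian_dualExponent hC hA β lam
  refine ⟨⟨_, gibbs_mem_densityMatrices hn hY, ?_⟩, ?_⟩
  · simp only [lagrangian_eq b hβ, trace_gibbs_mul_sub_entropy hn hY]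
  · rintro _ ⟨X, hX, rfl⟩
    simp only [lagrangian_eq b hβ]
    have := mul_le_mul_of_nonneg_left (trace_mul_sub_entropy_le hn hX hY) (inv_nonneg.2 hβ.le)
    linarith

/-- The gradient of the negated dual objective. -/
def negDualGradient (C : Matrix (Fin n) (Fin n) ℝ) (A : Fin m → Matrix (Fin n) (Fin n) ℝ)
    (b : EuclideanSpace ℝ (Fin m)) (β : ℝ) (lam : EuclideanSpace ℝ (Fin m)) :
    EuclideanSpace ℝ (Fin m) :=
  WithLp.toLp 2 (fun i => (A i * gibbs (dualExponent C A β lam)).trace) - b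

theorem inner_negDualGradient (b : EuclideanSpace ℝ (Fin m)) (β : ℝ)
    (lam μ : EuclideanSpace ℝ (Fin m)) :
    inner ℝ (negDualGradient C A b β lam) μ =
      (gibbs (dualExponent C A β lam) * dotMatrix A μ).trace - inner ℝ b μ := by
  rw [negDualGradient, inner_sub_left, trace_mul_dotMatrix, PiLp.inner_apply]
  simp

theorem isSmoothWrt_dualObjective (hn : 1 ≤ n) (hC : C.IsSymm) (hA : ∀ i, (A i).IsSymm)
    (b : EuclideanSpace ℝ (Fin m)) {β : ℝ} (hβ : 0 < β)
    (N : Seminorm ℝ (EuclideanSpace ℝ (Fin m))) (hN : ∀ x, N x = 0 → x = 0)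
    (hAN : ∀ lam, matrixNorm2 (dotMatrix A lam) ≤ N lam) :
    IsSmoothWrt β N (dualObjective C A b β) := by
  have hval : dualObjective C A b β = fun lam =>
      -(β⁻¹ * logPartition (dualExponent C A β lam) - inner ℝ b lam) := funext fun lam => by
    rw [neg_sub]
    exact (isLeast_lagrangian hn hC hA b hβ lam).csInf_eq
  have hH := isHermitian_dualExponent hC hA β
  set f : EuclideanSpace ℝ (Fin m) → ℝ :=
    fun lam => β⁻¹ * logPartition (dualExponent C A β lam) - inner ℝ b lam with hf
  set g := negDualGradient C A b β with hg
  have hsub : ∀ x y, f x + inner ℝ (g x) (y - x) ≤ f y := by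
    intro x y
    have h := logPartition_subgradient hn (hH x) (hH y)
    rw [dualExponent_sub, mul_smul_comm, Matrix.trace_smul, smul_eq_mul] at h
    have h2 := mul_le_mul_of_nonneg_left h (inv_nonneg.2 hβ.le)
    rw [mul_add, inv_mul_cancel_left₀ hβ.ne'] at h2
    simp only [hf, hg, inner_negDualGradient]
    rw [inner_sub_right]
    linarith
  have hcont : Continuous g := by
    have := continuous_gibbs_comp hn (continuous_dualExponent (C := C) (A := A) β) hH
    refine ((PiLp.continuous_toLp 2 _).comp (continuous_pi fun i => ?_)).sub continuous_const
    exact (continuous_const.matrix_mul this).matrix_trace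
  have hmon : ∀ x y, inner ℝ (g x - g y) (x - y) ≤ β * N (x - y) ^ 2 := by
    intro x y
    -- The exponent moves by `β • dotMatrix A (x - y)`, which puts `β²` on the right and `β` on the
    -- left; cancelling leaves the constant `β`.
    have h := trace_gibbs_sub_le hn (hH x) (hH y)
    rw [dualExponent_sub, mul_smul_comm, mul_smul_comm, Matrix.trace_smul, Matrix.trace_smul,
      smul_eq_mul, smul_eq_mul, matrixNorm2_smul, abs_of_pos hβ] at h
    rw [inner_sub_left, hg, inner_negDualGradient, inner_negDualGradient]
    have h2 := pow_le_pow_left₀ (norm_nonneg _) (hAN (x - y)) 2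
    have h3 := mul_le_mul_of_nonneg_left h2 hβ.le
    refine le_trans ?_ h3
    refine le_of_mul_le_mul_left ?_ hβ
    change _ ≤ β * (β * matrixNorm2 (dotMatrix A (x - y)) ^ 2)
    linarith
  have hgrad : ∀ x, HasGradientAt (dualObjective C A b β) (-g x) x := by
    intro x
    rw [hval, hasGradientAt_iff_hasFDerivAt, map_neg]
    exact (hasGradientAt_of_subgradient hsub hcont x).hasFDerivAt.neg
  refine ⟨fun x => (hgrad x).differentiableAt, fun x y => ?_⟩
  rw [(hgrad x).gradient, (hgrad y).gradient, neg_sub_neg, map_sub_rev]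
  exact dualNorm_sub_le N hN hβ.le hsub hcont hmon y x

end Dual

end EntropicSDP

end

/-- The dual objective is a genuine minimum, has the log-trace-exponential form, and is
`β`-smooth with respect to any norm `N` on `ℝᵐ` (a definite seminorm) that dominates
`λ ↦ ‖λ · A‖₂`. -/
theorem mainTheorem10 {n m : ℕ} (hn : 1 ≤ n)
    (C : Matrix (Fin n) (Fin n) ℝ) (hC : C.IsSymm)
    (A : Fin m → Matrix (Fin n) (Fin n) ℝ) (hA : ∀ i, (A i).IsSymm)
    (b : EuclideanSpace ℝ (Fin m)) (β : ℝ) (hβ : 0 < β)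
    (N : Seminorm ℝ (EuclideanSpace ℝ (Fin m))) (hN : ∀ x, N x = 0 → x = 0)
    (hAN : ∀ lam, EntropicSDP.matrixNorm2 (EntropicSDP.dotMatrix A lam) ≤ N lam) :
    (∀ lam, IsLeast ((fun X => EntropicSDP.lagrangian C A b β X lam) ''
        EntropicSDP.densityMatrices n) (EntropicSDP.dualObjective C A b β lam)) ∧
    (∀ lam, EntropicSDP.dualObjective C A b β lam =
        inner ℝ b lam - β⁻¹ * Real.log
          (NormedSpace.exp (-(β • (C - EntropicSDP.dotMatrix A lam)))).trace) ∧
    EntropicSDP.IsSmoothWrt β N (EntropicSDP.dualObjective C A b β) := by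
  have h := EntropicSDP.isLeast_lagrangian hn hC hA b hβ
  refine ⟨fun lam => ?_, fun lam => (h lam).csInf_eq,
    EntropicSDP.isSmoothWrt_dualObjective hn hC hA b hβ N hN hAN⟩
  rw [EntropicSDP.dualObjective, (h lam).csInf_eq]
  exact h lam
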